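/- Let $\bar{\mathbb R}=\mathbb R\cup\{-\infty\}$, and let $\mathbb T=\bar{\mathbb R}\cup\{a^\nu : a\in\mathbb R\}$ be the extended tropical semiring: $\{a^\nu\}$ is a second ("ghost") copy of $\mathbb R$, and $\mathbb T$ is totally ordered with least element $-\infty$, by $a\prec a^\nu$ for $a \in \mathbb R$, and by $a, a^\nu\prec b, b^\nu$ whenever $a<b$. Addition is $x\oplus y=\max_\prec\{x,y\}$ if $x\ne y$, $a\oplus a=a^\nu\oplus a^\nu=a^\nu$, and $(-\infty)\oplus(-\infty)=-\infty$. Multiplication is $a\odot b=a+b$, $a^\nu\odot b=a\odot b^\nu=a^\nu\odot b^\nu=(a+b)^\nu$, and $-\infty$ is absorbing. Put $\bar{\mathbb U}=\{a^\nu: a\in\mathbb R\}\cup\{-\infty\}$. Vectors $v_1,\dots,v_k\in\mathbb T^{(n)}$ are tropically dependent if there are $\alpha_1,\dots,\alpha_k\in\bar{\mathbb R}$, not all $-\infty$, with $\alpha_1v_1\oplus\cdots\oplus\alpha_kv_k\in\bar{\mathbb U}^{(n)}$; otherwise they are tropically independent. The tropical rank $\operatorname{rk}(A)$ of a matrix $A$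 over $\mathbb T$ is the maximal number of tropically independent rows of $A$. A $k\times k$ matrix $B$ over $\mathbb T$ is tropically nonsingular if $|B|=\bigoplus_{\sigma\in S_k}b_{1,\sigma(1)}\odot\cdots\odot b_{k,\sigma(k)}\notin\bar{\mathbb U}$. A $k\times k$ minor of $A$ is a submatrix on $k$ rows and $k$ columns of $A$; the empty minor ($k=0$) counts as nonsingular. For a matrix $A$ over the max-plus semiring $(\bar{\mathbb R},\max,+)$, the Develin--Santos--Sturmfels rank $\operatorname{rk}_D(A)$ is the largest $k$ such that $A$ has a $k\times k$ minor $B$ for which $\max_{\sigma\in S_k}\sum_i b_{i,\sigma(i)}$ is not $-\infty$ and is attained by exactly one permutation $\sigma$. **Proposition.** Let $A$ be an $m\times n$ matrix with entries in $\bar{\mathbb R}$, also viewed as a matrix over $\mathbb T$. Then $A$ has a tropically nonsingular minor of maximal size, and for every such minor $A_{\max}$, $$\operatorname{rk}_D(A)=\operatorname{size}(A_{\max})=\operatorname{rk}(A).$$ In particular $\operatorname{rk}_D(A)=\operatorname{rk}(A)$. -/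

import Mathlib

/-- The extended tropical semiring `𝕋 = (ℝ ∪ {-∞}) ∪ (ℝ^ν ∪ {-∞})`: two copies of the real line,
the real elements `a` and the ghost elements `a^ν`, with a common least element `-∞`. -/
inductive ExtTrop : Type
  | negInf : ExtTrop
  | real : ℝ → ExtTrop
  | ghost : ℝ → ExtTrop

namespace ExtTrop

/-- The ghost map `ν`. -/
def nu : ExtTrop → ExtTrop
  | negInf => negInf
  | real a => ghost a
  | ghost a => ghost a

/-- The strict order `≺` on `𝕋`: by underlying real value, and `a ≺ a^ν`; `-∞` is least. -/
def prec : ExtTrop → ExtTrop → Prop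
  | negInf, negInf => False
  | negInf, real _ => True
  | negInf, ghost _ => True
  | real _, negInf => False
  | ghost _, negInf => False
  | real a, real b => a < b
  | real a, ghost b => a ≤ b
  | ghost a, real b => a < b
  | ghost a, ghost b => a < b

open Classical in
/-- Tropical addition: the `≺`-maximum of two distinct elements, and `x ⊕ x = x^ν`
(with `-∞ ⊕ -∞ = -∞`). -/
noncomputable def add (x y : ExtTrop) : ExtTrop :=
  if x = y then nu x else if prec x y then y else x

/-- Tropical multiplication: addition of the underlying values; a product with a ghost factor is a
ghost, and `-∞` is absorbing. -/
noncomputable def mul : ExtTrop → ExtTrop → ExtTrop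
  | negInf, _ => negInf
  | real _, negInf => negInf
  | ghost _, negInf => negInf
  | real a, real b => real (a + b)
  | real a, ghost b => ghost (a + b)
  | ghost a, real b => ghost (a + b)
  | ghost a, ghost b => ghost (a + b)

noncomputable instance : Zero ExtTrop := ⟨negInf⟩
noncomputable instance : One ExtTrop := ⟨real 0⟩
noncomputable instance : Add ExtTrop := ⟨add⟩
noncomputable instance : Mul ExtTrop := ⟨mul⟩

theorem zero_def : (0 : ExtTrop) = negInf := rfl
theorem one_def : (1 : ExtTrop) = real 0 := rfl
theorem add_def (x y : ExtTrop) : x + y = add x y := rfl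
theorem mul_def (x y : ExtTrop) : x * y = mul x y := rfl

theorem add_comm' (x y : ExtTrop) : x + y = y + x := by
  simp only [add_def]
  cases x <;> cases y <;> simp only [add, nu, prec] <;> grind

theorem add_assoc' (x y z : ExtTrop) : x + y + z = x + (y + z) := by
  simp only [add_def]
  cases x <;> cases y <;> cases z <;> simp only [add] <;> grind [nu, prec]

theorem mul_comm' (x y : ExtTrop) : x * y = y * x := by
  simp only [mul_def]
  cases x <;> cases y <;> simp [mul, add_comm]

theorem mul_assoc' (x y z : ExtTrop) : x * y * z = x * (y * z) := by
  simp only [mul_def]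
  cases x <;> cases y <;> cases z <;> simp [mul, add_assoc]

theorem mul_add' (x y z : ExtTrop) : x * (y + z) = x * y + x * z := by
  simp only [mul_def, add_def]
  cases x <;> cases y <;> cases z <;> simp only [add] <;> grind [nu, prec, mul]

theorem zero_add' (x : ExtTrop) : 0 + x = x := by
  simp only [zero_def, add_def]
  cases x <;> simp [add, nu, prec]

theorem one_mul' (x : ExtTrop) : 1 * x = x := by
  simp only [one_def, mul_def]
  cases x <;> simp [mul]

/-- `(𝕋, ⊕, ⊙)` is a commutative semiring with zero `-∞` and unit the real number `0`. -/
noncomputable instance : CommSemiring ExtTrop where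
  add_assoc := add_assoc'
  zero_add := zero_add'
  add_zero x := by rw [add_comm', zero_add']
  add_comm := add_comm'
  nsmul := nsmulRec
  mul_assoc := mul_assoc'
  one_mul := one_mul'
  mul_one x := by rw [mul_comm', one_mul']
  mul_comm := mul_comm'
  zero_mul _ := rfl
  mul_zero x := by rw [mul_comm']; rfl
  left_distrib := mul_add'
  right_distrib x y z := by rw [mul_comm', mul_add', mul_comm' z x, mul_comm' z y]

/-- Membership in the ghost part with `-∞` adjoined. -/
def IsGhost (x : ExtTrop) : Prop := x = negInf ∨ ∃ a : ℝ, x = ghost a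

/-- The inclusion of `ℝ ∪ {-∞}` into `𝕋` as the real part with `-∞`. -/
def ofReal : WithBot ℝ → ExtTrop
  | ⊥ => negInf
  | (a : ℝ) => real a

/-- Vectors `v i` of `𝕋^(n)` are tropically dependent if some combination with coefficients in
`ℝ ∪ {-∞}`, not all of them `-∞`, has all its entries ghost or `-∞`. -/
def TropDependent {ι : Type*} [Fintype ι] {n : ℕ} (v : ι → Fin n → ExtTrop) : Prop :=
  ∃ α : ι → WithBot ℝ, (∃ i, α i ≠ ⊥) ∧ ∀ j, IsGhost (∑ i, ofReal (α i) * v i j)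

/-- The tropical rank of a matrix over `𝕋`: the maximal number of tropically independent rows. -/
noncomputable def tropicalRank {m n : ℕ} (A : Matrix (Fin m) (Fin n) ExtTrop) : ℕ :=
  sSup {k | ∃ s : Finset (Fin m), s.card = k ∧ ¬ TropDependent fun i : s => A i}

/-- The tropical determinant, `⊕` over permutations of the products of the entries. -/
noncomputable def tropDet {k : ℕ} (A : Matrix (Fin k) (Fin k) ExtTrop) : ExtTrop :=
  ∑ σ : Equiv.Perm (Fin k), ∏ i, A i (σ i)

/-- A square matrix over `𝕋` is tropically singular if its determinant is ghost or `-∞`. -/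
def TropSingular {k : ℕ} (A : Matrix (Fin k) (Fin k) ExtTrop) : Prop := IsGhost (tropDet A)

/-- The `k × k` minor of `A` on the rows `r` and the columns `c` is tropically nonsingular, and no
larger minor of `A` is. -/
def IsMaximalNonsingularMinor {m n : ℕ} (A : Matrix (Fin m) (Fin n) ExtTrop)
    {k : ℕ} (r : Fin k ↪o Fin m) (c : Fin k ↪o Fin n) : Prop :=
  ¬ TropSingular (A.submatrix r c) ∧
    ∀ (l : ℕ) (r' : Fin l ↪o Fin m) (c' : Fin l ↪o Fin n),
      ¬ TropSingular (A.submatrix r' c') → l ≤ k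

/-- The set defining the tropical rank has a greatest element. -/
theorem isGreatest_tropicalRank {m n : ℕ} (A : Matrix (Fin m) (Fin n) ExtTrop) :
    IsGreatest {k | ∃ s : Finset (Fin m), s.card = k ∧ ¬ TropDependent fun i : s => A i}
      (tropicalRank A) := by
  have hb : BddAbove
      {k | ∃ s : Finset (Fin m), s.card = k ∧ ¬ TropDependent fun i : s => A i} := by
    refine ⟨m, ?_⟩
    rintro k ⟨s, rfl, -⟩
    simpa using s.card_le_univ
  refine ⟨Nat.sSup_mem ⟨0, ∅, rfl, ?_⟩ hb, fun k hk => le_csSup hb hk⟩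
  rintro ⟨α, ⟨i, -⟩, -⟩
  exact absurd i.2 (Finset.notMem_empty _)

end ExtTrop

namespace MaxPlus

/-- The value of a permutation in a square matrix over `(ℝ ∪ {-∞}, max, +)`. -/
def weight {k : ℕ} (A : Matrix (Fin k) (Fin k) (WithBot ℝ)) (σ : Equiv.Perm (Fin k)) : WithBot ℝ :=
  ∑ i, A i (σ i)

/-- The max-plus determinant: the maximum of the values of the permutations. -/
noncomputable def det {k : ℕ} (A : Matrix (Fin k) (Fin k) (WithBot ℝ)) : WithBot ℝ :=
  Finset.univ.sup (weight A)

/-- Nonsingularity over the max-plus semiring: the maximum in the determinant is not `-∞` and is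
attained by exactly one permutation. -/
def Nonsingular {k : ℕ} (A : Matrix (Fin k) (Fin k) (WithBot ℝ)) : Prop :=
  det A ≠ ⊥ ∧ ∃! σ : Equiv.Perm (Fin k), weight A σ = det A

/-- The Develin-Santos-Sturmfels tropical rank: the largest size of a nonsingular minor. -/
noncomputable def rank {m n : ℕ} (A : Matrix (Fin m) (Fin n) (WithBot ℝ)) : ℕ :=
  sSup {k | ∃ (r : Fin k ↪o Fin m) (c : Fin k ↪o Fin n), Nonsingular (A.submatrix r c)}

/-- The set defining the Develin-Santos-Sturmfels rank has a greatest element. -/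
theorem isGreatest_rank {m n : ℕ} (A : Matrix (Fin m) (Fin n) (WithBot ℝ)) :
    IsGreatest {k | ∃ (r : Fin k ↪o Fin m) (c : Fin k ↪o Fin n), Nonsingular (A.submatrix r c)}
      (rank A) := by
  have hb : BddAbove
      {k | ∃ (r : Fin k ↪o Fin m) (c : Fin k ↪o Fin n), Nonsingular (A.submatrix r c)} := by
    refine ⟨m, ?_⟩
    rintro k ⟨r, -, -⟩
    simpa using Fintype.card_le_of_injective r r.injective
  refine ⟨Nat.sSup_mem ⟨0, Fin.castLEOrderEmb (Nat.zero_le m),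
    Fin.castLEOrderEmb (Nat.zero_le n), ?_⟩ hb, fun k hk => le_csSup hb hk⟩
  have h1 : ∀ B : Matrix (Fin 0) (Fin 0) (WithBot ℝ), det B = 0 := fun B => by
    simp [det, weight]
  refine ⟨by rw [h1]; exact WithBot.zero_ne_bot, 1, ?_, fun σ _ => Subsingleton.elim _ _⟩
  rw [h1]
  simp [weight]

end MaxPlus

/-! Everything reduces to one equivalence: given rows over ℝ ∪ {-∞} are tropically independent iff
they carry a nonsingular minor using all of them (`not_tropDependent_iff_exists_nonsingular`).
Dependence means coefficients exist such that no row strictly dominates the others in any column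
(`Balances`). If no such coefficients exist, shrink the sets of columns tested for each row as far
as possible. A set splitting into two solvable parts would be solvable, by the maximum of two
solutions normalised to agree at that row; so one column `g i` per row remains
(`exists_column_choice`). A competing assignment at least as good as `g` would give a potential
along its cycles, hence balanced coefficients (`strictlyOptimal_of_not_balances`). So `g` is the
unique optimum of a minor. Conversely, following dominating rows leads to a cycle, and summing
around it contradicts unique optimality (`StrictlyOptimal.not_balances`). -/

namespace ExtTrop

/-! ### Ghost sums in 𝕋 as maxima that are `-∞` or not uniquely attained. -/

/-- The underlying value of an element of the extended tropical semiring. -/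
def val : ExtTrop → WithBot ℝ
  | negInf => ⊥
  | real a => a
  | ghost a => a

theorem val_add (x y : ExtTrop) : val (x + y) = max (val x) (val y) := by
  rw [add_def]
  cases x <;> cases y <;> simp only [add, nu, prec] <;> grind [val, WithBot.coe_lt_coe, WithBot.coe_le_coe, bot_le]

theorem val_ofReal (a : WithBot ℝ) : val (ofReal a) = a := by
  cases a <;> rfl

theorem val_sum_ofReal {ι : Type*} (s : Finset ι) (c : ι → WithBot ℝ) :
    val (∑ i ∈ s, ofReal (c i)) = s.sup c := by
  classical
  induction s using Finset.induction_on with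
  | empty => rfl
  | insert a s ha ih => rw [Finset.sum_insert ha, val_add, ih, val_ofReal, Finset.sup_insert]

theorem ofReal_add (a b : WithBot ℝ) : ofReal (a + b) = ofReal a * ofReal b := by
  cases a <;> cases b <;> rfl

theorem ofReal_sum {ι : Type*} (s : Finset ι) (c : ι → WithBot ℝ) :
    ofReal (∑ i ∈ s, c i) = ∏ i ∈ s, ofReal (c i) := by
  classical
  induction s using Finset.induction_on with
  | empty => rfl
  | insert a s ha ih => rw [Finset.sum_insert ha, Finset.prod_insert ha, ofReal_add, ih]

theorem isGhost_ofReal (a : WithBot ℝ) : IsGhost (ofReal a) ↔ a = ⊥ := by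
  cases a <;> simp [IsGhost, ofReal]

theorem not_isGhost_add (x y : ExtTrop) :
    ¬ IsGhost (x + y) ↔ (¬ IsGhost x ∧ val y < val x) ∨ (¬ IsGhost y ∧ val x < val y) := by
  rw [add_def]
  cases x <;> cases y <;> simp only [add, nu, prec, val] <;> split_ifs <;>
    simp_all [IsGhost]
  all_goals grind

/-- A sum of non-ghost elements is non-ghost exactly when its maximum is finite and attained once. -/
theorem not_isGhost_sum_ofReal {ι : Type*} (s : Finset ι) (c : ι → WithBot ℝ) :
    ¬ IsGhost (∑ i ∈ s, ofReal (c i)) ↔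
      ∃ i ∈ s, c i ≠ ⊥ ∧ ∀ j ∈ s, j ≠ i → c j < c i := by
  classical
  induction s using Finset.induction_on with
  | empty =>
    simp only [Finset.sum_empty, Finset.notMem_empty, false_and, exists_false, iff_false, not_not]
    exact Or.inl rfl
  | insert a s ha ih =>
    rw [Finset.sum_insert ha, not_isGhost_add, ih, val_sum_ofReal, val_ofReal, isGhost_ofReal]
    constructor
    · rintro (⟨h0, h⟩ | ⟨⟨i, hi, h0, h⟩, h'⟩)
      · refine ⟨a, Finset.mem_insert_self _ _, h0, fun j hj hja => ?_⟩
        exact (Finset.le_sup (Finset.mem_of_mem_insert_of_ne hj hja)).trans_lt h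
      · refine ⟨i, Finset.mem_insert_of_mem hi, h0, fun j hj hji => ?_⟩
        rcases Finset.mem_insert.1 hj with rfl | hj
        · refine h'.trans_le (Finset.sup_le fun l hl => ?_)
          by_cases hli : l = i
          · rw [hli]
          · exact (h l hl hli).le
        · exact h j hj hji
    · rintro ⟨i, hi, h0, h⟩
      rcases Finset.mem_insert.1 hi with rfl | hi
      · refine Or.inl ⟨h0, (Finset.sup_lt_iff (bot_lt_iff_ne_bot.2 h0)).2 fun j hj => ?_⟩
        exact h j (Finset.mem_insert_of_mem hj) (by rintro rfl; exact ha hj)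
      · refine Or.inr ⟨⟨i, hi, h0, fun j hj => h j (Finset.mem_insert_of_mem hj)⟩, ?_⟩
        exact (h a (Finset.mem_insert_self _ _) (by rintro rfl; exact ha hi)).trans_le
          (Finset.le_sup hi)

theorem not_tropSingular_map_ofReal {k : ℕ} (B : Matrix (Fin k) (Fin k) (WithBot ℝ)) :
    ¬ TropSingular (B.map ofReal) ↔
      ∃ σ, MaxPlus.weight B σ ≠ ⊥ ∧ ∀ τ, τ ≠ σ → MaxPlus.weight B τ < MaxPlus.weight B σ := by
  have : tropDet (B.map ofReal) = ∑ σ : Equiv.Perm (Fin k), ofReal (MaxPlus.weight B σ) := by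
    simp only [tropDet, MaxPlus.weight, ofReal_sum, Matrix.map_apply]
  rw [TropSingular, this, not_isGhost_sum_ofReal]
  simp

theorem tropDependent_ofReal {ι : Type*} [Fintype ι] {n : ℕ} (b : ι → Fin n → WithBot ℝ) :
    TropDependent (fun i j => ofReal (b i j)) ↔
      ∃ α : ι → WithBot ℝ, (∃ i, α i ≠ ⊥) ∧
        ∀ i j, α i + b i j = ⊥ ∨ ∃ l, l ≠ i ∧ α i + b i j ≤ α l + b l j := by
  have h (α : ι → WithBot ℝ) (j : Fin n) : IsGhost (∑ i, ofReal (α i) * ofReal (b i j)) ↔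
      ∀ i, α i + b i j = ⊥ ∨ ∃ l, l ≠ i ∧ α i + b i j ≤ α l + b l j := by
    have := not_isGhost_sum_ofReal Finset.univ fun i => α i + b i j
    rw [← not_iff_not]
    simp only [ofReal_add] at this
    rw [this]
    push Not
    simp
  simp only [TropDependent, h]
  exact exists_congr fun α => and_congr_right fun _ => forall_comm

theorem tropDependent_comp_equiv {ι κ : Type*} [Fintype ι] [Fintype κ] {n : ℕ} (e : ι ≃ κ)
    (v : κ → Fin n → ExtTrop) : TropDependent (fun i => v (e i)) ↔ TropDependent v := by
  constructor
  · rintro ⟨α, ⟨i, hi⟩, h⟩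
    refine ⟨α ∘ e.symm, ⟨e i, by simpa using hi⟩, fun j => ?_⟩
    rw [← e.sum_comp]
    simpa using h j
  · rintro ⟨α, ⟨i, hi⟩, h⟩
    refine ⟨α ∘ e, ⟨e.symm i, by simpa using hi⟩, fun j => ?_⟩
    have := h j
    rw [← e.sum_comp] at this
    exact this

end ExtTrop

namespace MaxPlus

theorem nonsingular_iff {k : ℕ} (B : Matrix (Fin k) (Fin k) (WithBot ℝ)) :
    Nonsingular B ↔ ∃ σ, weight B σ ≠ ⊥ ∧ ∀ τ, τ ≠ σ → weight B τ < weight B σ := by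
  have hle (σ) : weight B σ ≤ det B := Finset.le_sup (Finset.mem_univ σ)
  constructor
  · rintro ⟨h0, σ, hσ, h⟩
    simp only at hσ h
    refine ⟨σ, hσ ▸ h0, fun τ hτ => ?_⟩
    rw [hσ]
    exact lt_of_le_of_ne (hle τ) fun h' => hτ (h τ h')
  · rintro ⟨σ, h0, h⟩
    have hd : weight B σ = det B := by
      refine le_antisymm (hle σ) (Finset.sup_le fun τ _ => ?_)
      by_cases hτ : τ = σ
      · rw [hτ]
      · exact (h τ hτ).le
    refine ⟨hd ▸ h0, σ, hd, fun τ hτ => ?_⟩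
    by_contra hne
    exact ((h τ hne).trans_eq hd).ne hτ

/-! ### Balanced coefficients and reduction to one column per row. -/

/-- Column choices with finite entries for which every nontrivial reassignment of the rows
is strictly worse. -/
def StrictlyOptimal {ι κ : Type*} [Fintype ι] (b : ι → κ → WithBot ℝ) (g : ι → κ) : Prop :=
  (∀ i, b i (g i) ≠ ⊥) ∧
    ∀ τ : Equiv.Perm ι, τ ≠ 1 → ∑ i, b (τ i) (g i) < ∑ i, b i (g i)

/-- Row coefficients, not all `-∞`, with no row `i` strictly dominating a finite column of `D i`. -/
def Balances {ι κ : Type*} (b : ι → κ → WithBot ℝ) (D : ι → Finset κ) (x : ι → WithBot ℝ) : Prop :=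
  (∃ i, x i ≠ ⊥) ∧
    ∀ i, ∀ j ∈ D i, x i + b i j = ⊥ ∨ ∃ l, l ≠ i ∧ x i + b i j ≤ x l + b l j

section
variable {ι κ : Type*} {b : ι → κ → WithBot ℝ}

theorem Balances.add_const {D : ι → Finset κ} {x : ι → WithBot ℝ} (h : Balances b D x) (t : ℝ) :
    Balances b D fun i => x i + t := by
  obtain ⟨⟨i, hi⟩, h⟩ := h
  refine ⟨⟨i, by simpa [WithBot.add_eq_bot] using hi⟩, fun i j hj => ?_⟩
  rcases h i j hj with h | ⟨l, hl, h⟩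
  · left
    rw [add_right_comm, h, WithBot.bot_add]
  · refine Or.inr ⟨l, hl, ?_⟩
    rw [add_right_comm, add_right_comm (x l)]
    gcongr

/-- Balanced coefficients for two constraint systems that differ in one row only, and agree at
that row, have a maximum balanced for the joint system. -/
theorem Balances.sup {D D₁ D₂ : ι → Finset κ} {x y : ι → WithBot ℝ} (i : ι)
    (hx : Balances b D₁ x) (hy : Balances b D₂ y) (hi : x i = y i)
    (hD : ∀ j ∈ D i, j ∈ D₁ i ∨ j ∈ D₂ i) (hne : ∀ l, l ≠ i → D l ⊆ D₁ l ∧ D l ⊆ D₂ l) :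
    Balances b D (x ⊔ y) := by
  have key₁ (l j) (hj : j ∈ D₁ l) (h : y l ≤ x l) :
      (x ⊔ y) l + b l j = ⊥ ∨ ∃ p, p ≠ l ∧ (x ⊔ y) l + b l j ≤ (x ⊔ y) p + b p j := by
    rw [Pi.sup_apply, sup_eq_left.2 h]
    -- Row `l` keeps its coefficient while the others can only grow, so the domination survives.
    refine (hx.2 l j hj).imp_right fun ⟨p, hp, h⟩ => ⟨p, hp, h.trans ?_⟩
    gcongr
    exact le_sup_left
  have key₂ (l j) (hj : j ∈ D₂ l) (h : x l ≤ y l) :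
      (x ⊔ y) l + b l j = ⊥ ∨ ∃ p, p ≠ l ∧ (x ⊔ y) l + b l j ≤ (x ⊔ y) p + b p j := by
    rw [Pi.sup_apply, sup_eq_right.2 h]
    refine (hy.2 l j hj).imp_right fun ⟨p, hp, h⟩ => ⟨p, hp, h.trans ?_⟩
    gcongr
    exact le_sup_right
  refine ⟨?_, fun l j hj => ?_⟩
  · obtain ⟨l, hl⟩ := hx.1
    exact ⟨l, fun h => hl (le_bot_iff.1 (h ▸ le_sup_left))⟩
  · by_cases hl : l = i
    · subst hl
      exact (hD j hj).elim (fun h => key₁ l j h hi.ge) fun h => key₂ l j h hi.le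
    · exact (le_total (y l) (x l)).elim (key₁ l j ((hne l hl).1 hj))
        (key₂ l j ((hne l hl).2 hj))

/-- A row with coefficient `-∞` meets its constraints trivially, whatever its column set. -/
theorem Balances.of_eq_bot {D D' : ι → Finset κ} {x : ι → WithBot ℝ} (i : ι) (h : Balances b D' x)
    (hi : x i = ⊥) (hne : ∀ l, l ≠ i → D l ⊆ D' l) : Balances b D x := by
  refine ⟨h.1, fun l j hj => ?_⟩
  by_cases hl : l = i
  · left
    rw [hl, hi, WithBot.bot_add]
  · exact h.2 l j (hne l hl hj)

theorem balances_single [DecidableEq ι] {D : ι → Finset κ} (i : ι) (h : ∀ j ∈ D i, b i j = ⊥) :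
    Balances b D fun l => if l = i then 0 else ⊥ := by
  refine ⟨⟨i, by simp⟩, fun l j hj => Or.inl ?_⟩
  by_cases hl : l = i
  · subst hl
    simp [h j hj]
  · simp [hl]

/-- If the constraint system of all columns has no balanced coefficients, then one column per row
suffices for that. -/
theorem exists_column_choice [Finite ι] [Finite κ] {D : ι → Finset κ}
    (h : ¬ ∃ x, Balances b D x) : ∃ g : ι → κ, ¬ ∃ x, Balances b (fun i => {g i}) x := by
  classical
  obtain ⟨E, -, hE⟩ := (Set.toFinite {E : ι → Finset κ | ¬ ∃ x, Balances b E x}).exists_le_minimal h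
  have hlt (i : ι) (s : Finset κ) (hs : s ⊂ E i) : ∃ x, Balances b (Function.update E i s) x := by
    by_contra hcon
    have hle : Function.update E i s ≤ E := by
      intro l
      by_cases hl : l = i
      · subst hl; simpa using hs.subset
      · simp [hl]
    have := hE.2 hcon hle i
    rw [Function.update_self] at this
    exact hs.2 this
  have hcard (i : ι) : ∃ j, E i = {j} := by
    have hne : (E i).Nonempty := by
      rw [Finset.nonempty_iff_ne_empty]
      intro he
      exact hE.1 ⟨_, balances_single i (by simp [he])⟩
    obtain ⟨j, hj⟩ := hne
    refine ⟨j, ?_⟩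
    by_contra hne
    have hss : {j} ⊂ E i :=
      (Finset.singleton_subset_iff.2 hj).ssubset_of_ne (Ne.symm hne)
    -- By minimality both parts of `E i`, namely `{j}` and the rest, are solvable; gluing the
    -- solutions would solve `E`.
    obtain ⟨x, hx⟩ := hlt i {j} hss
    obtain ⟨y, hy⟩ := hlt i ((E i).erase j) (Finset.erase_ssubset hj)
    have hsub (s : Finset κ) (l : ι) (hl : l ≠ i) : E l ⊆ Function.update E i s l := by
      simp [hl]
    by_cases hxi : x i = ⊥
    · exact hE.1 ⟨x, hx.of_eq_bot i hxi (hsub _)⟩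
    by_cases hyi : y i = ⊥
    · exact hE.1 ⟨y, hy.of_eq_bot i hyi (hsub _)⟩
    obtain ⟨p, hp⟩ := WithBot.ne_bot_iff_exists.1 hxi
    obtain ⟨q, hq⟩ := WithBot.ne_bot_iff_exists.1 hyi
    refine hE.1 ⟨_, hx.sup i (hy.add_const (p - q)) ?_ ?_ fun l hl => ⟨hsub _ l hl, hsub _ l hl⟩⟩
    · rw [← hp, ← hq, ← WithBot.coe_add]
      congr 1
      ring
    · intro l hl
      by_cases hlj : l = j
      · simp [hlj]
      · simp [hlj, hl]
  choose g hg using hcard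
  refine ⟨g, ?_⟩
  rw [← funext hg]
  exact hE.1

/-! ### Cycles, potentials and strict optimality. -/

/-- If a permutation moves a point and the weights along it have nonnegative sum, then on an
invariant set of moved points there is a potential whose decrease is bounded by the weights. -/
theorem exists_potential [Fintype ι] (τ : Equiv.Perm ι) (hτ : τ ≠ 1) (w : ι → ℝ)
    (hfix : ∀ i, τ i = i → w i = 0) (hw : 0 ≤ ∑ i, w i) :
    ∃ (s : Set ι) (u : ι → ℝ), s.Nonempty ∧
      ∀ i ∈ s, τ i ≠ i ∧ τ i ∈ s ∧ u i ≤ w i + u (τ i) := by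
  classical
  set N := orderOf τ with hN
  have hNpos : 0 < N := orderOf_pos τ
  -- Partial sums of `w` along the orbit; at length `N` they are constant on cycles.
  let S : ℕ → ι → ℝ := fun m i => ∑ t ∈ Finset.range m, w ((τ ^ t) i)
  have hS (m : ℕ) (i : ι) : S (m + 1) i = w i + S m (τ i) := by
    simp only [S, Finset.sum_range_succ', pow_zero, Equiv.Perm.one_apply, pow_succ,
      Equiv.Perm.mul_apply]
    ring
  have hSN (i : ι) : S N (τ i) = S N i := by
    have h1 := hS N i
    have h2 : S (N + 1) i = S N i + w ((τ ^ N) i) := Finset.sum_range_succ _ _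
    rw [hN, pow_orderOf_eq_one, ← hN, Equiv.Perm.one_apply] at h2
    linarith
  have hsum : ∑ i, S N i = N * ∑ i, w i := by
    simp only [S]
    rw [Finset.sum_comm]
    simp [Equiv.sum_comp (τ ^ _) w]
  have hS0 (i : ι) (hi : τ i = i) : S N i = 0 := by
    refine Finset.sum_eq_zero fun t _ => ?_
    rw [Equiv.Perm.pow_apply_eq_self_of_apply_eq_self hi, hfix i hi]
  -- The potential is the largest partial sum of length at least 1, so that `w i` can be split off;
  -- the empty remainder is then bounded by the full sum `S N`, nonnegative on this set.
  refine ⟨{i | τ i ≠ i ∧ 0 ≤ S N i},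
    fun i => (Finset.Icc 1 N).sup' ⟨1, by simp; omega⟩ fun m => S m i, ?_, ?_⟩
  · by_contra hempty
    rw [Set.not_nonempty_iff_eq_empty, Set.eq_empty_iff_forall_notMem] at hempty
    simp only [Set.mem_ofPred_eq, not_and, not_le] at hempty
    obtain ⟨i, hi⟩ : ∃ i, τ i ≠ i := by
      by_contra! hcon
      exact hτ (Equiv.ext hcon)
    have : ∑ i, S N i < ∑ _i : ι, (0 : ℝ) := by
      refine Finset.sum_lt_sum (fun j _ => ?_) ⟨i, Finset.mem_univ _, hempty i hi⟩
      by_cases hj : τ j = j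
      · exact (hS0 j hj).le
      · exact (hempty j hj).le
    rw [hsum, Finset.sum_const_zero] at this
    exact this.not_ge (by positivity)
  · rintro i ⟨hi, h0⟩
    refine ⟨hi, ⟨fun h => hi (τ.injective h), (hSN i).symm ▸ h0⟩, ?_⟩
    refine Finset.sup'_le _ _ fun m hm => ?_
    obtain ⟨h1, h2⟩ := Finset.mem_Icc.1 hm
    obtain ⟨m, rfl⟩ := Nat.exists_eq_add_of_le' h1
    rw [hS]
    gcongr
    rcases Nat.eq_zero_or_pos m with rfl | hm0
    · calc S 0 (τ i) = 0 := by simp [S]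
        _ ≤ S N (τ i) := (hSN i).symm ▸ h0
        _ ≤ _ := Finset.le_sup' (fun m => S m (τ i)) (Finset.mem_Icc.2 ⟨hNpos, le_rfl⟩)
    · exact Finset.le_sup' (fun m => S m (τ i)) (Finset.mem_Icc.2 ⟨hm0, by omega⟩)

/-- For a competing `τ`, a potential for the gains `b (τ i) (g i) - b i (g i)` serves as
coefficients: row `τ i` dominates row `i` in column `g i`. -/
theorem strictlyOptimal_of_not_balances [Fintype ι] {g : ι → κ}
    (h : ¬ ∃ x, Balances b (fun i => {g i}) x) : StrictlyOptimal b g := by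
  classical
  have h0 (i : ι) : b i (g i) ≠ ⊥ := fun hi =>
    h ⟨_, balances_single i (by simpa using hi)⟩
  refine ⟨h0, fun τ hτ => ?_⟩
  by_contra hle
  rw [not_lt] at hle
  have h1 (i : ι) : b (τ i) (g i) ≠ ⊥ := by
    intro hi
    have : ∑ i, b (τ i) (g i) = ⊥ := WithBot.sum_eq_bot_iff.2 ⟨i, Finset.mem_univ _, hi⟩
    rw [this, le_bot_iff, WithBot.sum_eq_bot_iff] at hle
    obtain ⟨l, -, hl⟩ := hle
    exact h0 l hl
  choose p hp using fun i => WithBot.ne_bot_iff_exists.1 (h0 i)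
  choose q hq using fun i => WithBot.ne_bot_iff_exists.1 (h1 i)
  simp only [← hp, ← hq, ← WithBot.coe_sum, WithBot.coe_le_coe] at hle
  obtain ⟨s, u, ⟨i₀, hi₀⟩, hs⟩ := exists_potential τ hτ (fun i => q i - p i)
    (fun i hi => by
      have := hq i
      rw [hi, ← hp] at this
      exact sub_eq_zero.2 (WithBot.coe_injective this))
    (by simpa using hle)
  refine h ⟨fun i => if i ∈ s then (u i : WithBot ℝ) else ⊥, ⟨i₀, by simp [hi₀]⟩, ?_⟩
  intro i j hj
  rw [Finset.mem_singleton] at hj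
  subst hj
  by_cases hi : i ∈ s
  · obtain ⟨hne, hmem, hu⟩ := hs i hi
    refine Or.inr ⟨τ i, hne, ?_⟩
    simp only [hi, hmem, if_true, ← hp, ← hq, ← WithBot.coe_add, WithBot.coe_le_coe]
    linarith
  · simp [hi]

/-- Swapping two rows that share a column would not change the sum. -/
theorem StrictlyOptimal.injective [Fintype ι] {g : ι → κ} (h : StrictlyOptimal b g) :
    Function.Injective g := by
  classical
  intro i l hil
  by_contra hne
  refine (h.2 (Equiv.swap i l) (by simpa [Equiv.swap_eq_one_iff] using hne)).ne ?_
  rw [← Equiv.sum_comp (Equiv.swap i l) fun p => b p (g p)]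
  refine Finset.sum_congr rfl fun p _ => ?_
  congr 1
  by_cases hpi : p = i
  · simp [hpi, hil]
  · by_cases hpl : p = l
    · simp [hpl, hil]
    · rw [Equiv.swap_apply_of_ne_of_ne hpi hpl]

/-- A strictly optimal column choice leaves no balanced coefficients. -/
theorem StrictlyOptimal.not_balances [Fintype ι] {g : ι → κ} (h : StrictlyOptimal b g) :
    ¬ ∃ x, Balances b (fun i => {g i}) x := by
  classical
  rintro ⟨x, ⟨i₀, hi₀⟩, hx⟩
  have hex (i : ι) (hi : x i ≠ ⊥) : ∃ l, l ≠ i ∧ x i + b i (g i) ≤ x l + b l (g i) :=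
    (hx i (g i) (by simp)).resolve_left (by simp [WithBot.add_eq_bot, hi, h.1 i])
  choose! f hf using hex
  have hfx (i : ι) (hi : x i ≠ ⊥) : x (f i) ≠ ⊥ := by
    intro hbot
    have := (hf i hi).2
    rw [hbot, WithBot.bot_add, le_bot_iff, WithBot.add_eq_bot] at this
    exact this.elim hi (h.1 i)
  have hit (m : ℕ) : x (f^[m] i₀) ≠ ⊥ := by
    induction m with
    | zero => exact hi₀
    | succ m ih => rw [Function.iterate_succ_apply']; exact hfx _ ih
  -- On its periodic points `f` is a bijection, so it extends by the identity to a permutation.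
  set P : Set ι := {i | x i ≠ ⊥ ∧ i ∈ Function.periodicPts f} with hP
  have hmaps : Set.MapsTo f P P := fun i hi =>
    ⟨hfx i hi.1, (Function.bijOn_periodicPts f).mapsTo hi.2⟩
  have hinj : Set.InjOn f P := (Function.bijOn_periodicPts f).injOn.mono fun i hi => hi.2
  obtain ⟨i₁, hi₁⟩ : P.Nonempty := by
    obtain ⟨m, m', hne, heq⟩ := Finite.exists_ne_map_eq_of_infinite fun m : ℕ => f^[m] i₀
    wlog hlt : m < m' generalizing m m'
    · exact this m' m hne.symm heq.symm (by omega)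
    refine ⟨f^[m] i₀, hit m, Function.mk_mem_periodicPts (n := m' - m) (by omega) ?_⟩
    rw [Function.IsPeriodicPt, Function.IsFixedPt, ← Function.iterate_add_apply,
      Nat.sub_add_cancel hlt.le]
    exact heq.symm
  have hτinj : Function.Injective fun i => if i ∈ P then f i else i := by
    intro i l hil
    by_cases hi : i ∈ P <;> by_cases hl : l ∈ P <;> simp only [hi, hl, if_true, if_false] at hil
    · exact hinj hi hl hil
    · exact absurd (hil ▸ hmaps hi) hl
    · exact absurd (hil ▸ hmaps hl) hi
    · exact hil
  set τ : Equiv.Perm ι := Equiv.ofBijective _ (Finite.injective_iff_bijective.1 hτinj) with hτ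
  have hτP (i : ι) (hi : i ∈ P) : τ i = f i := by simp [hτ, hi]
  have hτP' (i : ι) (hi : i ∉ P) : τ i = i := by simp [hτ, hi]
  have hτ1 : τ ≠ 1 := fun h1 => (hf i₁ hi₁.1).1 (by rw [← hτP i₁ hi₁, h1, Equiv.Perm.one_apply])
  -- Replacing `-∞` by 0 makes the coefficient sum finite, hence cancellable; the affected rows lie
  -- outside `P` and are fixed by `τ`.
  let y : ι → WithBot ℝ := fun i => if x i = ⊥ then 0 else x i
  have hle : ∑ i, (y i + b i (g i)) ≤ ∑ i, (y (τ i) + b (τ i) (g i)) := by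
    refine Finset.sum_le_sum fun i _ => ?_
    by_cases hi : i ∈ P
    · rw [hτP i hi]
      simp only [y, hi.1, hfx i hi.1, if_false]
      exact (hf i hi.1).2
    · rw [hτP' i hi]
  rw [Finset.sum_add_distrib, Finset.sum_add_distrib, Equiv.sum_comp τ y] at hle
  refine (h.2 τ hτ1).not_ge (WithBot.le_of_add_le_add_left ?_ hle)
  rw [Ne, WithBot.sum_eq_bot_iff]
  rintro ⟨i, -, hi⟩
  by_cases hxi : x i = ⊥ <;> simp [y, hxi] at hi

end

/-! ### From column choices to minors and ranks. -/

theorem sum_perm_apply {k n : ℕ} (B : Matrix (Fin k) (Fin n) (WithBot ℝ)) (c : Fin k → Fin n)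
    (σ τ : Equiv.Perm (Fin k)) :
    ∑ i, B (τ i) (c (σ i)) = weight (B.submatrix id c) (σ * τ⁻¹) := by
  rw [weight, ← Equiv.sum_comp τ fun i => B.submatrix id c i ((σ * τ⁻¹) i)]
  simp

/-- Tropical independence of rows over `ℝ ∪ {-∞}` is the existence of a nonsingular minor
on these rows. -/
theorem not_tropDependent_iff_exists_nonsingular {k n : ℕ} (B : Matrix (Fin k) (Fin n) (WithBot ℝ)) :
    ¬ ExtTrop.TropDependent (B.map ExtTrop.ofReal) ↔
      ∃ c : Fin k ↪o Fin n, Nonsingular (B.submatrix id c) := by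
  have hdep : ExtTrop.TropDependent (B.map ExtTrop.ofReal) ↔
      ∃ x, Balances B (fun _ => Finset.univ) x := by
    refine (ExtTrop.tropDependent_ofReal B).trans ?_
    simp [Balances]
  rw [hdep]
  constructor
  · intro h
    obtain ⟨g, hg⟩ := exists_column_choice h
    have hopt := strictlyOptimal_of_not_balances hg
    have hcard : (Finset.univ.image g).card = k := by
      rw [Finset.card_image_of_injective _ hopt.injective, Finset.card_univ, Fintype.card_fin]
    set c := (Finset.univ.image g).orderEmbOfFin hcard with hc
    have hex (i : Fin k) : ∃ p, c p = g i := by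
      have : g i ∈ Set.range c := by
        rw [hc, Finset.range_orderEmbOfFin]
        simp
      exact this
    choose π hπ using hex
    have hπinj : Function.Injective π := fun i l hil =>
      hopt.injective (by rw [← hπ, ← hπ, hil])
    let σ : Equiv.Perm (Fin k) := Equiv.ofBijective π (Finite.injective_iff_bijective.1 hπinj)
    have hσ (τ : Equiv.Perm (Fin k)) :
        ∑ i, B (τ i) (g i) = weight (B.submatrix id c) (σ * τ⁻¹) := by
      rw [← sum_perm_apply B c σ τ]
      simp [σ, hπ]
    have hσ1 := hσ 1
    simp only [Equiv.Perm.one_apply, inv_one, mul_one] at hσ1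
    refine ⟨c, (nonsingular_iff _).2 ⟨σ, ?_, fun τ hτ => ?_⟩⟩
    · rw [← hσ1, Ne, WithBot.sum_eq_bot_iff]
      rintro ⟨i, -, hi⟩
      exact hopt.1 i hi
    -- This row permutation is chosen since `σ * (τ⁻¹ * σ)⁻¹ = τ`.
    · have := hopt.2 (τ⁻¹ * σ) (by rwa [Ne, inv_mul_eq_one])
      rw [hσ, hσ1] at this
      simpa using this
  · rintro ⟨c, hc⟩ ⟨x, hx⟩
    obtain ⟨σ, h0, h⟩ := (nonsingular_iff _).1 hc
    have hopt : StrictlyOptimal B fun i => c (σ i) := by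
      refine ⟨fun i hi => h0 (WithBot.sum_eq_bot_iff.2 ⟨i, Finset.mem_univ _, hi⟩),
        fun τ hτ => ?_⟩
      rw [sum_perm_apply B c σ τ]
      exact h (σ * τ⁻¹) (by simpa using hτ)
    exact hopt.not_balances ⟨x, hx.1, fun i j _ => hx.2 i j (Finset.mem_univ _)⟩

/-- The Develin-Santos-Sturmfels rank is the tropical rank of the matrix over `𝕋`. -/
theorem rank_eq_tropicalRank {m n : ℕ} (A : Matrix (Fin m) (Fin n) (WithBot ℝ)) :
    rank A = ExtTrop.tropicalRank (A.map ExtTrop.ofReal) := by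
  rw [rank, ExtTrop.tropicalRank]
  congr 1
  ext k
  constructor
  · rintro ⟨r, c, h⟩
    refine ⟨Finset.univ.map r.toEmbedding, by simp, ?_⟩
    let e : Fin k ≃ (Finset.univ.map r.toEmbedding : Finset (Fin m)) :=
      Equiv.ofBijective (fun i => ⟨r i, by simp⟩)
        ⟨fun i l hil => r.injective (congrArg Subtype.val hil), fun ⟨p, hp⟩ => by
          obtain ⟨i, -, rfl⟩ := Finset.mem_map.1 hp
          exact ⟨i, rfl⟩⟩
    rw [← ExtTrop.tropDependent_comp_equiv e]
    exact (not_tropDependent_iff_exists_nonsingular (A.submatrix r id)).2 ⟨c, h⟩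
  · rintro ⟨s, hs, h⟩
    rw [← ExtTrop.tropDependent_comp_equiv (s.orderIsoOfFin hs).toEquiv] at h
    obtain ⟨c, hc⟩ := (not_tropDependent_iff_exists_nonsingular
      (A.submatrix (s.orderEmbOfFin hs) id)).1 h
    exact ⟨s.orderEmbOfFin hs, c, hc⟩

theorem nonsingular_submatrix_iff {m n k : ℕ} (A : Matrix (Fin m) (Fin n) (WithBot ℝ))
    (r : Fin k ↪o Fin m) (c : Fin k ↪o Fin n) :
    Nonsingular (A.submatrix r c) ↔
      ¬ ExtTrop.TropSingular ((A.map ExtTrop.ofReal).submatrix r c) := by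
  rw [nonsingular_iff, ← ExtTrop.not_tropSingular_map_ofReal, Matrix.submatrix_map]

end MaxPlus

theorem mainTheorem10 (m n : ℕ) (A : Matrix (Fin m) (Fin n) (WithBot ℝ)) :
    (∃ (k : ℕ) (r : Fin k ↪o Fin m) (c : Fin k ↪o Fin n),
      ExtTrop.IsMaximalNonsingularMinor (A.map ExtTrop.ofReal) r c) ∧
    (∀ (k : ℕ) (r : Fin k ↪o Fin m) (c : Fin k ↪o Fin n),
      ExtTrop.IsMaximalNonsingularMinor (A.map ExtTrop.ofReal) r c →
        MaxPlus.rank A = k ∧ k = ExtTrop.tropicalRank (A.map ExtTrop.ofReal)) ∧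
    MaxPlus.rank A = ExtTrop.tropicalRank (A.map ExtTrop.ofReal) := by
  obtain ⟨⟨r₀, c₀, h₀⟩, hmax⟩ := MaxPlus.isGreatest_rank A
  have hrank := MaxPlus.rank_eq_tropicalRank A
  refine ⟨⟨_, r₀, c₀, (MaxPlus.nonsingular_submatrix_iff A r₀ c₀).1 h₀, fun l r c h =>
    hmax ⟨r, c, (MaxPlus.nonsingular_submatrix_iff A r c).2 h⟩⟩, fun k r c h => ?_, hrank⟩
  have hk : MaxPlus.rank A = k :=
    le_antisymm (h.2 _ r₀ c₀ ((MaxPlus.nonsingular_submatrix_iff A r₀ c₀).1 h₀))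
      (hmax ⟨r, c, (MaxPlus.nonsingular_submatrix_iff A r c).2 h.1⟩)
  exact ⟨hk, hk ▸ hrank⟩
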